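/- Conventions. For integers $p\ge 0$, $k\ge -1$ and $n\ge 1$ let $\mathcal S_{p,k,n}$ be the space of splines of degree $p$ and smoothness $k$ on $n$ uniform segments: the functions $f\in C^k([0,1])$ whose restriction to each interval $[\frac jn,\frac{j+1}n)$, $j=0,\dots,n-1$, is a polynomial of degree at most $p$ (for $k=-1$ no continuity is required). Let $\|\cdot\|$ be the norm of $L^2(0,1)$ and let $\Pi_{p,k,n}$ be the $L^2(0,1)$-orthogonal projection onto $\mathcal S_{p,k,n}$. For $0\le q\le p$ let $C^{(q)}_{p,k,n}$ be the smallest real number such that $$\|f-\Pi_{p,k,n}f\|\le C^{(q)}_{p,k,n}\,\|\partial^{q+1}f\|\qquad\text{for all } f\in H^{q+1}(0,1),$$ and write $C_{q,k,n}=C^{(q)}_{q,k,n}$. Put $$R_{q,k,n}=\Big(\frac{4}{e\pi}\cdot\frac{n(q+1)}{(q-k)(n-1)+1}\Big)^{q+1}\sqrt{4q+6}.$$ Theorem. Let $q\ge 0$ and $-1\le k<q-1$ be integers, and suppose that $R_{q,k,\bar n}<1$ for some integer $\bar n\ge 1$. Let $p\ge q$ and $n\ge 1$ be integers with $$n\ge\frac{p-k-1}{q-k-1}\,\bar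 n .$$ Then $m=(q-k)(n-1)+1+q-p$ is a positive integer, both constants below exist (as smallest real numbers), and $$C^{(q)}_{p,p-1,m}<C_{q,k,n}.$$ -/

import Mathlib

open MeasureTheory Set
open scoped ContDiff

noncomputable section

namespace SplineApprox

/-- Lebesgue measure on the unit interval `(0,1)`. -/
abbrev unitMeasure : Measure ℝ := volume.restrict (Ioo (0 : ℝ) 1)

/-- The real Hilbert space `L²(0,1)`. -/
abbrev L2 : Type := Lp ℝ 2 unitMeasure

/-- The half-open interval `I_j = [j/n, (j+1)/n)` of the uniform partition of `[0,1]`. -/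
def cell (n : ℕ+) (j : ℕ) : Set ℝ := Ico ((j : ℝ) / (n : ℕ)) (((j : ℝ) + 1) / (n : ℕ))

/-- `f` is a spline of degree `p`, smoothness `k` on `n` uniform segments: it is `C^k` on `[0,1]`
and a polynomial of degree at most `p` on each cell.  For `k = -1` the smoothness
condition is empty, so that jumps are allowed. -/
def IsSpline (p : ℕ) (k : ℤ) (n : ℕ+) (f : ℝ → ℝ) : Prop :=
  (∀ r : ℕ, (r : ℤ) ≤ k → ContDiffOn ℝ r f (Icc 0 1)) ∧
  ∀ j : ℕ, j < n → ∃ P ∈ Polynomial.degreeLE ℝ p, ∀ x ∈ cell n j, f x = P.eval x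

/-- The spline space, as a subspace of `L²(0,1)`. -/
def splineSpace (p : ℕ) (k : ℤ) (n : ℕ+) : Submodule ℝ L2 where
  carrier := {u | ∃ f : ℝ → ℝ, IsSpline p k n f ∧ u =ᵐ[unitMeasure] f}
  add_mem' := by
    rintro u v ⟨f, ⟨hf, hf'⟩, huf⟩ ⟨g, ⟨hg, hg'⟩, hvg⟩
    refine ⟨f + g, ⟨fun r hr => (hf r hr).add (hg r hr), fun j hj => ?_⟩,
      (Lp.coeFn_add u v).trans (huf.add hvg)⟩
    obtain ⟨P, hP, hfP⟩ := hf' j hj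
    obtain ⟨Q, hQ, hgQ⟩ := hg' j hj
    exact ⟨P + Q, Submodule.add_mem _ hP hQ, fun x hx => by simp [hfP x hx, hgQ x hx]⟩
  zero_mem' := by
    refine ⟨0, ⟨fun r _ => contDiffOn_const, fun j _ => ⟨0, Submodule.zero_mem _, ?_⟩⟩,
      Lp.coeFn_zero _ _ _⟩
    intro x _
    simp
  smul_mem' := by
    rintro c u ⟨f, ⟨hf, hf'⟩, huf⟩
    refine ⟨c • f, ⟨fun r hr => contDiffOn_const.smul (hf r hr), fun j hj => ?_⟩,
      (Lp.coeFn_smul c u).trans (huf.const_smul c)⟩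
    obtain ⟨P, hP, hfP⟩ := hf' j hj
    exact ⟨c • P, Submodule.smul_mem _ c hP, fun x hx => by simp [hfP x hx]⟩

/-- The monomial `x^i` cut off to the cell `j`. -/
def piece (n : ℕ+) (j i : ℕ) : ℝ → ℝ := (cell n j).indicator fun x => x ^ i

theorem memLp_piece (n : ℕ+) (j i : ℕ) : MemLp (piece n j i) 2 unitMeasure := by
  refine MemLp.indicator measurableSet_Ico ?_
  refine MemLp.of_bound (by fun_prop) 1 ?_
  filter_upwards [ae_restrict_mem measurableSet_Ioo] with x hx
  rw [norm_pow, Real.norm_eq_abs, abs_of_pos hx.1]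
  exact pow_le_one₀ hx.1.le hx.2.le

theorem exists_cell (n : ℕ+) {x : ℝ} (hx : x ∈ Ioo (0 : ℝ) 1) :
    ∃ j : ℕ, j < n ∧ ∀ i : ℕ, x ∈ cell n i ↔ i = j := by
  have hn : (0 : ℝ) < (n : ℕ) := by exact_mod_cast n.pos
  have h0 : 0 ≤ x * (n : ℕ) := mul_nonneg hx.1.le hn.le
  refine ⟨⌊x * (n : ℕ)⌋₊, ?_, fun i => ?_⟩
  · rw [Nat.floor_lt h0]
    nlinarith [hx.2]
  · rw [eq_comm, Nat.floor_eq_iff h0, cell, mem_Ico, div_le_iff₀ hn, lt_div_iff₀ hn]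

theorem splineSpace_finiteDimensional (p : ℕ) (k : ℤ) (n : ℕ+) :
    FiniteDimensional ℝ (splineSpace p k n) := by
  let W : Submodule ℝ L2 := Submodule.span ℝ
    (range fun a : Fin n × Fin (p + 1) => (memLp_piece n a.1 a.2).toLp (piece n a.1 a.2))
  have hW : FiniteDimensional ℝ W := FiniteDimensional.span_of_finite ℝ (finite_range _)
  let Q : (ℝ → ℝ) → Prop := fun f => ∃ h : MemLp f 2 unitMeasure, h.toLp f ∈ W
  have Qadd : ∀ f g, Q f → Q g → Q (f + g) := by
    rintro f g ⟨hf, hf'⟩ ⟨hg, hg'⟩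
    exact ⟨hf.add hg, by rw [MemLp.toLp_add hf hg]; exact W.add_mem hf' hg'⟩
  have Qzero : Q 0 := ⟨MemLp.zero, by rw [MemLp.toLp_zero]; exact W.zero_mem⟩
  have Qsmul : ∀ (c : ℝ) f, Q f → Q (c • f) := by
    rintro c f ⟨hf, hf'⟩
    exact ⟨hf.const_smul c, by rw [MemLp.toLp_const_smul c hf]; exact W.smul_mem c hf'⟩
  suffices h : splineSpace p k n ≤ W from Submodule.finiteDimensional_of_le h
  rintro u ⟨f, ⟨-, hf⟩, huf⟩
  choose! P hP hfP using hf
  have hQ : Q (∑ j : Fin n, ∑ i : Fin (p + 1), (P j).coeff i • piece n j i) := by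
    refine Finset.sum_induction _ Q Qadd Qzero fun j _ => ?_
    refine Finset.sum_induction _ Q Qadd Qzero fun i _ => ?_
    exact Qsmul _ _ ⟨memLp_piece n j i, Submodule.subset_span ⟨(j, i), rfl⟩⟩
  obtain ⟨hm, hmW⟩ := hQ
  have : u = hm.toLp _ := by
    refine Lp.ext (huf.trans (Filter.EventuallyEq.trans ?_ hm.coeFn_toLp.symm))
    filter_upwards [ae_restrict_mem measurableSet_Ioo] with x hx
    obtain ⟨j, hj, hcell⟩ := exists_cell n hx
    have hdeg : (P j).natDegree < p + 1 :=
      Nat.lt_succ_of_le (Polynomial.natDegree_le_of_degree_le (Polynomial.mem_degreeLE.1 (hP j hj)))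
    rw [hfP j hj x ((hcell j).2 rfl), Polynomial.eval_eq_sum_range' hdeg]
    simp only [Finset.sum_apply, Pi.smul_apply, smul_eq_mul]
    rw [Finset.sum_eq_single (⟨j, hj⟩ : Fin n)]
    · rw [Finset.sum_range]
      refine Finset.sum_congr rfl fun i _ => ?_
      rw [piece, indicator_of_mem ((hcell j).2 rfl)]
    · intro b _ hb
      refine Finset.sum_eq_zero fun i _ => ?_
      have hb' : (b : ℕ) ≠ j := fun h => hb (Fin.ext h)
      rw [piece, indicator_of_notMem (fun h => hb' ((hcell b).1 h)), mul_zero]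
    · simp
  rw [this]
  exact hmW

instance (p : ℕ) (k : ℤ) (n : ℕ+) : FiniteDimensional ℝ (splineSpace p k n) :=
  splineSpace_finiteDimensional p k n

/-- The `L²(0,1)`-orthogonal projection onto the spline space. -/
def proj (p : ℕ) (k : ℤ) (n : ℕ+) : L2 →L[ℝ] L2 := (splineSpace p k n).starProjection

/-- `g` is the `r`-th weak derivative of `f` on `(0,1)`. -/
def IsWeakDeriv (r : ℕ) (f g : L2) : Prop :=
  ∀ φ : ℝ → ℝ, ContDiff ℝ ∞ φ → HasCompactSupport φ → tsupport φ ⊆ Ioo 0 1 →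
    ∫ x in Ioo (0 : ℝ) 1, f x * iteratedDeriv r φ x
      = (-1) ^ r * ∫ x in Ioo (0 : ℝ) 1, g x * φ x

/-- The Sobolev space `H^s(0,1)`: the functions in `L²(0,1)` all of whose weak derivatives
of order at most `s` exist and are in `L²(0,1)`. -/
def sobolev (s : ℕ) : Set L2 := {f | ∀ r ≤ s, ∃ g : L2, IsWeakDeriv r f g}

/-- The real numbers `C` such that `‖f - Π f‖ ≤ C ‖∂^(q+1) f‖` for all `f ∈ H^(q+1)(0,1)`, where
`Π` is the `L²` projection onto the splines of degree `p`, smoothness `k` on `n` segments. -/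
def errorBounds (p : ℕ) (k : ℤ) (n : ℕ+) (q : ℕ) : Set ℝ :=
  {C | ∀ f ∈ sobolev (q + 1), ∀ g : L2, IsWeakDeriv (q + 1) f g → ‖f - proj p k n f‖ ≤ C * ‖g‖}

/-- The optimal constant `C^{(q)}_{p,k,n}`. -/
def optConst (p : ℕ) (k : ℤ) (n : ℕ+) (q : ℕ) : ℝ := sInf (errorBounds p k n q)

/-- `B_{p,k,n} = 4/(eπ) · n(p+1) / ((p-k)(n-1)+1)`. -/
def ratioBase (p : ℕ) (k : ℤ) (n : ℕ+) : ℝ :=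
  4 / (Real.exp 1 * Real.pi) *
    (((n : ℕ) : ℝ) * ((p : ℝ) + 1) / (((p : ℝ) - (k : ℝ)) * (((n : ℕ) : ℝ) - 1) + 1))

/-- `R_{p,k,n} = B_{p,k,n}^(p+1) √(4p+6)`. -/
def ratioBound (p : ℕ) (k : ℤ) (n : ℕ+) : ℝ :=
  ratioBase p k n ^ (p + 1) * Real.sqrt (4 * (p : ℝ) + 6)

end SplineApprox

end

/-!
The proof bounds the left constant from above, the right constant from below, and compares.

*Upper bound.* For `q ≤ p` the constant of the smooth splines of degree `p` on `m` cells is at most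
`(1 / (m π)) ^ (q + 1)` (`pow_mem_errorBounds`). Let `u' = g` and let `e` be the error of `u` in
degree `p`. Since `e` has mean zero, its primitive `W` vanishes at `0` and `1`, so that
`‖e‖² = ⟪e, u⟫ = -⟪W, g⟫`.
For `p = 0` the function `W` vanishes at all nodes, and the sharp Dirichlet inequality
`‖W‖ ≤ ‖e‖ / (m π)` on the cells gives `‖e‖ ≤ ‖g‖ / (m π)` (`norm_sub_proj_zero_le`).
For `p + 1` a primitive of the projection of `g` in degree `p` is a spline of degree `p + 1`, so `g`
may be replaced with its error `w`, and then `W` with its own error in degree `p`, as `w` is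
orthogonal to the splines. Hence a first-order bound `C` in degree `p` gives
`‖e‖ ≤ C ‖w‖` in degree `p + 1` (`norm_sub_proj_succ_le`). Iterating this inequality
along the derivatives of `u` gives the bound of order `q + 1`; the Dirichlet inequality itself
follows from the Riccati equation solved by `α tan (α x)`.

*Lower bound.* The function `x ^ (q + 1)` has a constant derivative of order `q + 1`, and on each
cell its distance to the polynomials of degree `q` is the norm of a monic Legendre polynomial
(`le_integral_sq_of_monic`). This bounds `C_{q,k,n}` from below for every `k`
(`le_of_mem_errorBounds`).

*Comparison.* Stirling's bound `(2N)! / N! ≤ √2 (4N / e) ^ N` with `N = q + 1`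
(`factorial_two_mul_le`) shows that the quotient of the two bounds is at most `R_{q,k,n}`, with
`m` in the place of `(q - k)(n - 1) + 1`; the hypothesis on `n` makes this at most
`R_{q,k,nbar} < 1`.
-/

namespace SplineApprox

/-! ### Absolutely continuous functions -/

/-- Integration by parts with almost everywhere derivatives in the place of `deriv`. -/
theorem integral_mul_eq_sub_of_absolutelyContinuous {f g f' g' : ℝ → ℝ} {a b : ℝ}
    (hf : AbsolutelyContinuousOnInterval f a b) (hg : AbsolutelyContinuousOnInterval g a b)
    (hf' : ∀ᵐ x, x ∈ uIcc a b → HasDerivAt f (f' x) x)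
    (hg' : ∀ᵐ x, x ∈ uIcc a b → HasDerivAt g (g' x) x) :
    ∫ x in a..b, f x * g' x = f b * g b - f a * g a - ∫ x in a..b, f' x * g x := by
  have h1 : ∫ x in a..b, f x * g' x = ∫ x in a..b, f x * deriv g x := by
    refine intervalIntegral.integral_congr_ae ?_
    filter_upwards [hg'] with x hx hxm
    rw [(hx (uIoc_subset_uIcc hxm)).deriv]
  have h2 : ∫ x in a..b, f' x * g x = ∫ x in a..b, deriv f x * g x := by
    refine intervalIntegral.integral_congr_ae ?_
    filter_upwards [hf'] with x hx hxm
    rw [(hx (uIoc_subset_uIcc hxm)).deriv]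
  rw [h1, h2, hf.integral_mul_deriv_eq_deriv_mul hg]

/-- A Dirichlet inequality with a constant below the sharp one, by comparison with the Riccati
equation `T' = α² + T²`, solved by `T x = α tan (α (x - c))` where `c` is the midpoint of `[a, b]`:
integrating `0 ≤ (w' + T w)²` and `(T w²)'` gives the claim. The solution exists on all of `[a, b]`
as long as `α (b - a) < π`. -/
theorem sq_mul_integral_sq_le_of_lt {w w' : ℝ → ℝ} {a b α : ℝ} (hab : a ≤ b) (hα : 0 ≤ α)
    (hαb : α * (b - a) < Real.pi)
    (hw : AbsolutelyContinuousOnInterval w a b)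
    (hw' : ∀ᵐ x, x ∈ uIcc a b → HasDerivAt w (w' x) x)
    (hi : IntervalIntegrable w' volume a b)
    (hi2 : IntervalIntegrable (fun x => w' x ^ 2) volume a b) (ha : w a = 0) (hb : w b = 0) :
    α ^ 2 * ∫ x in a..b, w x ^ 2 ≤ ∫ x in a..b, w' x ^ 2 := by
  set T : ℝ → ℝ := fun x => α * Real.tan (α * (x - (a + b) / 2)) with hT
  have hcos : ∀ x ∈ uIcc a b, Real.cos (α * (x - (a + b) / 2)) ≠ 0 := by
    intro x hx
    rw [uIcc_of_le hab] at hx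
    refine (Real.cos_pos_of_mem_Ioo ⟨?_, ?_⟩).ne'
    · nlinarith [mul_nonneg hα (sub_nonneg.2 hx.1)]
    · nlinarith [mul_nonneg hα (sub_nonneg.2 hx.2)]
  have hTd : ∀ x ∈ uIcc a b, HasDerivAt T (α ^ 2 + T x ^ 2) x := by
    intro x hx
    have h := ((Real.hasDerivAt_tan (hcos x hx)).comp x
      (((hasDerivAt_id x).sub_const ((a + b) / 2)).const_mul α)).const_mul α
    refine h.congr_deriv ?_
    have hs := Real.sin_sq_add_cos_sq (α * (x - (a + b) / 2))
    have hc := hcos x hx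
    simp only [hT, Real.tan_eq_sin_div_cos]
    generalize α * (x - (a + b) / 2) = θ at hs hc
    field_simp
    linear_combination α ^ 2 * (-hs)
  have hTc : ContDiffOn ℝ 1 T (uIcc a b) := by
    intro x hx
    have htan : ContDiffAt ℝ 1 (Real.tan ∘ fun x => α * (x - (a + b) / 2)) x :=
      (Real.contDiffAt_tan.2 (hcos x hx)).comp x (by fun_prop)
    exact (contDiffAt_const.mul htan).contDiffWithinAt
  have hTa := hTc.absolutelyContinuousOnInterval
  have hTw : AbsolutelyContinuousOnInterval (fun x => T x * w x) a b := hTa.fun_mul hw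
  have hibp := integral_mul_eq_sub_of_absolutelyContinuous
    (f' := fun x => (α ^ 2 + T x ^ 2) * w x + T x * w' x) hTw hw ?_ hw'
  swap
  · filter_upwards [hw'] with x hx hxm
    exact (hTd x hxm).mul (hx hxm)
  simp only [ha, hb, mul_zero, sub_zero, zero_sub] at hibp
  have hwc := hw.continuousOn
  have hTcc := hTc.continuousOn
  have i1 : IntervalIntegrable (fun x => T x * w x * w' x) volume a b :=
    hi.continuousOn_mul (hTcc.mul hwc)
  have i2 : IntervalIntegrable (fun x => α ^ 2 * w x ^ 2) volume a b :=
    ContinuousOn.intervalIntegrable (by fun_prop)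
  have i3 : IntervalIntegrable (fun x => T x ^ 2 * w x ^ 2) volume a b :=
    ContinuousOn.intervalIntegrable (by fun_prop)
  have e1 : ∫ x in a..b, ((α ^ 2 + T x ^ 2) * w x + T x * w' x) * w x
      = (∫ x in a..b, α ^ 2 * w x ^ 2) + (∫ x in a..b, T x ^ 2 * w x ^ 2)
        + ∫ x in a..b, T x * w x * w' x := by
    rw [← intervalIntegral.integral_add i2 i3, ← intervalIntegral.integral_add (i2.add i3) i1]
    congr 1; ext x; ring
  have e2 : ∫ x in a..b, (w' x + T x * w x) ^ 2
      = (∫ x in a..b, w' x ^ 2) + 2 * (∫ x in a..b, T x * w x * w' x)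
        + ∫ x in a..b, T x ^ 2 * w x ^ 2 := by
    rw [← intervalIntegral.integral_const_mul, ← intervalIntegral.integral_add hi2 (i1.const_mul 2),
      ← intervalIntegral.integral_add (hi2.add (i1.const_mul 2)) i3]
    congr 1; ext x; ring
  have e3 : 0 ≤ ∫ x in a..b, (w' x + T x * w x) ^ 2 :=
    intervalIntegral.integral_nonneg hab fun x _ => sq_nonneg _
  rw [intervalIntegral.integral_const_mul] at e1
  linarith

/-- The Poincaré–Wirtinger inequality with Dirichlet boundary conditions and the sharp constant. -/
theorem integral_sq_le_of_eq_zero_of_eq_zero {w w' : ℝ → ℝ} {a b : ℝ} (hab : a < b)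
    (hw : AbsolutelyContinuousOnInterval w a b)
    (hw' : ∀ᵐ x, x ∈ uIcc a b → HasDerivAt w (w' x) x)
    (hi : IntervalIntegrable w' volume a b)
    (hi2 : IntervalIntegrable (fun x => w' x ^ 2) volume a b) (ha : w a = 0) (hb : w b = 0) :
    ∫ x in a..b, w x ^ 2 ≤ ((b - a) / Real.pi) ^ 2 * ∫ x in a..b, w' x ^ 2 := by
  have hba : 0 < b - a := sub_pos.2 hab
  -- The constant `π / (b - a)` itself is reached as a limit of admissible values of `α`.
  have key : ∀ t ∈ Ico (0 : ℝ) 1,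
      (t * (Real.pi / (b - a))) ^ 2 * ∫ x in a..b, w x ^ 2 ≤ ∫ x in a..b, w' x ^ 2 := by
    intro t ht
    refine sq_mul_integral_sq_le_of_lt hab.le
      (mul_nonneg ht.1 (div_nonneg Real.pi_pos.le hba.le)) ?_ hw hw' hi hi2 ha hb
    rw [mul_assoc, div_mul_cancel₀ _ hba.ne']
    nlinarith [ht.2, Real.pi_pos]
  have hlim : (1 * (Real.pi / (b - a))) ^ 2 * ∫ x in a..b, w x ^ 2 ≤ ∫ x in a..b, w' x ^ 2 := by
    have hc : ContinuousWithinAt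
        (fun t : ℝ => (t * (Real.pi / (b - a))) ^ 2 * ∫ x in a..b, w x ^ 2) (Ico 0 1) 1 := by
      fun_prop
    exact hc.closure_le (by rw [closure_Ico zero_ne_one]; simp) continuousWithinAt_const key
  have hπ := Real.pi_pos
  calc ∫ x in a..b, w x ^ 2
      = ((b - a) / Real.pi) ^ 2 * ((1 * (Real.pi / (b - a))) ^ 2 * ∫ x in a..b, w x ^ 2) := by
        field_simp
    _ ≤ _ := mul_le_mul_of_nonneg_left hlim (sq_nonneg _)

/-! ### Primitives in `L²(0,1)` -/

theorem integral_unitMeasure (F : ℝ → ℝ) : ∫ x, F x ∂unitMeasure = ∫ x in (0 : ℝ)..1, F x := by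
  rw [intervalIntegral.integral_of_le zero_le_one, integral_Ioc_eq_integral_Ioo]

theorem ae_unitMeasure_iff {P : ℝ → Prop} :
    (∀ᵐ x ∂unitMeasure, P x) ↔ ∀ᵐ x, x ∈ Icc (0 : ℝ) 1 → P x := by
  rw [unitMeasure, Measure.restrict_congr_set Ioo_ae_eq_Icc, ae_restrict_iff' measurableSet_Icc]

theorem inner_eq_intervalIntegral (u v : L2) : inner ℝ u v = ∫ x in (0 : ℝ)..1, u x * v x := by
  rw [L2.inner_def, integral_unitMeasure]
  simp [mul_comm]

theorem norm_sq_eq_intervalIntegral (u : L2) : ‖u‖ ^ 2 = ∫ x in (0 : ℝ)..1, u x ^ 2 := by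
  rw [← real_inner_self_eq_norm_sq, inner_eq_intervalIntegral]
  simp [sq]

theorem intervalIntegrable_iff_unitMeasure {F : ℝ → ℝ} :
    IntervalIntegrable F volume 0 1 ↔ Integrable F unitMeasure := by
  rw [intervalIntegrable_iff_integrableOn_Ioo_of_le zero_le_one, IntegrableOn]

theorem intervalIntegrable_coe (u : L2) : IntervalIntegrable u volume 0 1 :=
  intervalIntegrable_iff_unitMeasure.2 ((Lp.memLp u).integrable one_le_two)

theorem intervalIntegrable_coe_sq (u : L2) : IntervalIntegrable (fun x => u x ^ 2) volume 0 1 :=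
  intervalIntegrable_iff_unitMeasure.2 (Lp.memLp u).integrable_sq

theorem memLp_of_continuousOn {f : ℝ → ℝ} (hf : ContinuousOn f (Icc 0 1)) :
    MemLp f 2 unitMeasure := by
  obtain ⟨C, hC⟩ := isCompact_Icc.exists_bound_of_continuousOn hf
  refine MemLp.of_bound ((hf.mono Ioo_subset_Icc_self).aestronglyMeasurable measurableSet_Ioo) C ?_
  filter_upwards [ae_restrict_mem measurableSet_Ioo] with x hx
  exact hC x (Ioo_subset_Icc_self hx)

theorem absolutelyContinuous_primitive (g : L2) (c : ℝ) :
    AbsolutelyContinuousOnInterval (fun x => c + ∫ t in (0 : ℝ)..x, g t) 0 1 :=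
  (contDiffOn_const (c := c)).absolutelyContinuousOnInterval.fun_add
    ((intervalIntegrable_coe g).absolutelyContinuousOnInterval_intervalIntegral (by simp))

theorem ae_hasDerivAt_primitive (g : L2) (c : ℝ) :
    ∀ᵐ x, x ∈ uIcc (0 : ℝ) 1 → HasDerivAt (fun x => c + ∫ t in (0 : ℝ)..x, g t) (g x) x := by
  filter_upwards [(intervalIntegrable_coe g).ae_hasDerivAt_integral] with x hx hxm
  exact (hx hxm 0 (by simp)).const_add c

/-- `u` is a primitive of `g`, that is, `u` belongs to `H¹(0,1)` and has derivative `g`. This is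
expressed through the fundamental theorem of calculus, up to null sets. -/
def IsPrimitive (u g : L2) : Prop :=
  ∃ c : ℝ, u =ᵐ[unitMeasure] fun x => c + ∫ t in (0 : ℝ)..x, g t

theorem exists_ae_eq_primitive (g : L2) (c : ℝ) :
    ∃ u : L2, u =ᵐ[unitMeasure] fun x => c + ∫ t in (0 : ℝ)..x, g t := by
  have h := (absolutelyContinuous_primitive g c).continuousOn
  rw [uIcc_of_le zero_le_one] at h
  exact ⟨(memLp_of_continuousOn h).toLp _, (memLp_of_continuousOn h).coeFn_toLp⟩

theorem IsPrimitive.sub {u v g h : L2} (hu : IsPrimitive u g) (hv : IsPrimitive v h) :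
    IsPrimitive (u - v) (g - h) := by
  obtain ⟨c, hc⟩ := hu
  obtain ⟨d, hd⟩ := hv
  refine ⟨c - d, ?_⟩
  filter_upwards [hc, hd, Lp.coeFn_sub u v, ae_restrict_mem measurableSet_Ioo] with x h1 h2 h3 hx
  have hsub : uIcc 0 x ⊆ uIcc (0 : ℝ) 1 := by
    rw [uIcc_of_le hx.1.le, uIcc_of_le zero_le_one]
    exact Icc_subset_Icc_right hx.2.le
  have h4 : ∫ t in (0 : ℝ)..x, (g - h) t = ∫ t in (0 : ℝ)..x, (g t - h t) := by
    refine intervalIntegral.integral_congr_ae ?_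
    filter_upwards [ae_unitMeasure_iff.1 (Lp.coeFn_sub g h)] with t ht htm
    have := hsub (uIoc_subset_uIcc htm)
    rw [uIcc_of_le zero_le_one] at this
    simpa using ht this
  rw [h3, Pi.sub_apply, h1, h2, h4, intervalIntegral.integral_sub
    ((intervalIntegrable_coe g).mono_set hsub) ((intervalIntegrable_coe h).mono_set hsub)]
  ring

/-- Integration by parts against a primitive of `e` vanishing at both end points. -/
theorem IsPrimitive.inner_eq_neg_inner {u g e W : L2} (hu : IsPrimitive u g)
    (he : ∫ t in (0 : ℝ)..1, e t = 0)
    (hW : W =ᵐ[unitMeasure] fun x => 0 + ∫ t in (0 : ℝ)..x, e t) :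
    inner ℝ e u = - inner ℝ W g := by
  obtain ⟨c, hc⟩ := hu
  have h := integral_mul_eq_sub_of_absolutelyContinuous
    (absolutelyContinuous_primitive e 0) (absolutelyContinuous_primitive g c)
    (ae_hasDerivAt_primitive e 0) (ae_hasDerivAt_primitive g c)
  simp only [he, intervalIntegral.integral_same, add_zero, zero_mul, sub_zero, zero_sub] at h
  have h1 : inner ℝ e u = ∫ x in (0 : ℝ)..1, e x * (c + ∫ t in (0 : ℝ)..x, g t) := by
    rw [inner_eq_intervalIntegral, ← integral_unitMeasure, ← integral_unitMeasure]
    refine integral_congr_ae ?_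
    filter_upwards [hc] with x hx
    rw [hx]
  have h2 : inner ℝ W g = ∫ x in (0 : ℝ)..1, (0 + ∫ t in (0 : ℝ)..x, e t) * g x := by
    rw [inner_eq_intervalIntegral, ← integral_unitMeasure, ← integral_unitMeasure]
    refine integral_congr_ae ?_
    filter_upwards [hW] with x hx
    rw [hx]
  rw [h1, h2, h, neg_neg]

/-! ### Weak derivatives -/

theorem integral_Ioo_eq_intervalIntegral (F : ℝ → ℝ) :
    ∫ x in Ioo (0 : ℝ) 1, F x = ∫ x in (0 : ℝ)..1, F x :=
  integral_unitMeasure F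

theorem tsupport_iteratedDeriv_subset (φ : ℝ → ℝ) (r : ℕ) :
    tsupport (iteratedDeriv r φ) ⊆ tsupport φ := by
  induction r with
  | zero => simp
  | succ r ih =>
    rw [iteratedDeriv_succ]
    exact tsupport_deriv_subset.trans ih

theorem contDiff_iteratedDeriv {φ : ℝ → ℝ} (hφ : ContDiff ℝ ∞ φ) (r : ℕ) :
    ContDiff ℝ ∞ (iteratedDeriv r φ) := by
  rw [iteratedDeriv_eq_iterate]
  exact hφ.iterate_deriv r

theorem hasCompactSupport_iteratedDeriv {φ : ℝ → ℝ} (hφ : HasCompactSupport φ) (r : ℕ) :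
    HasCompactSupport (iteratedDeriv r φ) :=
  hφ.mono' ((subset_tsupport _).trans (tsupport_iteratedDeriv_subset φ r))

/-- A weak derivative of order `r + 1` is a weak derivative of order `r` of the first one. -/
theorem IsWeakDeriv.of_succ {r : ℕ} {f g h : L2} (hg : IsWeakDeriv 1 f g)
    (hh : IsWeakDeriv (r + 1) f h) : IsWeakDeriv r g h := by
  intro φ hφ hc hs
  have h1 := hg (iteratedDeriv r φ) (contDiff_iteratedDeriv hφ r)
    (hasCompactSupport_iteratedDeriv hc r) ((tsupport_iteratedDeriv_subset φ r).trans hs)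
  have h2 := hh φ hφ hc hs
  rw [iteratedDeriv_one, ← iteratedDeriv_succ] at h1
  rw [h1, pow_one, pow_succ] at h2
  linarith

theorem IsWeakDeriv.succ {r : ℕ} {f g h : L2} (hg : IsWeakDeriv r f g)
    (hh : IsWeakDeriv 1 g h) : IsWeakDeriv (r + 1) f h := by
  intro φ hφ hc hs
  have h1 := hh φ hφ hc hs
  have h2 := hg (iteratedDeriv 1 φ) (contDiff_iteratedDeriv hφ 1)
    (hasCompactSupport_iteratedDeriv hc 1) ((tsupport_iteratedDeriv_subset φ 1).trans hs)
  rw [iteratedDeriv_succ']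
  rw [iteratedDeriv_one] at h1 h2
  rw [h2, h1, pow_succ]
  ring

theorem isWeakDeriv_zero_self (f : L2) : IsWeakDeriv 0 f f := by
  intro φ _ _ _
  simp

theorem absolutelyContinuous_of_contDiff {φ : ℝ → ℝ} (hφ : ContDiff ℝ ∞ φ) (a b : ℝ) :
    AbsolutelyContinuousOnInterval φ a b :=
  ((hφ.of_le (by simp)).contDiffOn (s := uIcc a b)).absolutelyContinuousOnInterval

theorem IsPrimitive.isWeakDeriv {u g : L2} (hu : IsPrimitive u g) : IsWeakDeriv 1 u g := by
  intro φ hφ hc hs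
  obtain ⟨c, hc⟩ := hu
  have h0 : φ 0 = 0 := image_eq_zero_of_notMem_tsupport fun h => lt_irrefl _ (hs h).1
  have h1 : φ 1 = 0 := image_eq_zero_of_notMem_tsupport fun h => lt_irrefl _ (hs h).2
  have h := integral_mul_eq_sub_of_absolutelyContinuous (absolutelyContinuous_primitive g c)
    (absolutelyContinuous_of_contDiff hφ 0 1) (ae_hasDerivAt_primitive g c)
    (Filter.Eventually.of_forall fun x _ => (hφ.differentiable (by simp) x).hasDerivAt)
  rw [h0, h1, mul_zero, mul_zero, sub_zero, zero_sub] at h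
  rw [integral_Ioo_eq_intervalIntegral (fun x => g x * φ x), iteratedDeriv_one, pow_one,
    neg_one_mul, ← h, ← integral_unitMeasure]
  refine integral_congr_ae ?_
  filter_upwards [hc] with x hx
  rw [hx]

theorem exists_Icc_of_isCompact_subset_Ioo {K : Set ℝ} (hK : IsCompact K) (hne : K.Nonempty)
    (hs : K ⊆ Ioo 0 1) : ∃ a b : ℝ, 0 < a ∧ b < 1 ∧ K ⊆ Icc a b :=
  ⟨sInf K, sSup K, (hs (hK.sInf_mem hne)).1, (hs (hK.sSup_mem hne)).2, fun _ hx =>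
    ⟨csInf_le hK.bddBelow hx, le_csSup hK.bddAbove hx⟩⟩

/-- A test function on `(0,1)` with integral zero is the derivative of a test function. -/
theorem exists_deriv_eq_of_integral_eq_zero {χ : ℝ → ℝ} (hχ : ContDiff ℝ ∞ χ) {a b : ℝ}
    (ha : 0 < a) (hb : b < 1) (hs : ∀ x ∉ Icc a b, χ x = 0)
    (h0 : ∫ x in (0 : ℝ)..1, χ x = 0) :
    ∃ ψ : ℝ → ℝ, ContDiff ℝ ∞ ψ ∧ HasCompactSupport ψ ∧ tsupport ψ ⊆ Ioo 0 1 ∧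
      deriv ψ = χ := by
  have hder : ∀ x, HasDerivAt (fun x => ∫ t in (0 : ℝ)..x, χ t) (χ x) x := fun x =>
    (hχ.continuous.integral_hasStrictDerivAt 0 x).hasDerivAt
  have hd : deriv (fun x => ∫ t in (0 : ℝ)..x, χ t) = χ := funext fun x => (hder x).deriv
  have hz : ∀ x ∉ Icc a b, ∫ t in (0 : ℝ)..x, χ t = 0 := by
    intro x hx
    rw [mem_Icc, not_and_or, not_le, not_le] at hx
    rcases hx with hx | hx
    · refine (intervalIntegral.integral_congr fun t ht => ?_).trans
        (intervalIntegral.integral_zero (a := 0) (b := x))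
      refine hs t fun h => ?_
      have := ht.2
      rcases le_max_iff.1 this with h' | h' <;> linarith [h.1]
    · rw [← intervalIntegral.integral_add_adjacent_intervals
        (hχ.continuous.intervalIntegrable 0 1) (hχ.continuous.intervalIntegrable 1 x), h0, zero_add]
      refine (intervalIntegral.integral_congr fun t ht => ?_).trans
        (intervalIntegral.integral_zero (a := 1) (b := x))
      refine hs t fun h => ?_
      have := ht.1
      rcases min_le_iff.1 this with h' | h' <;> linarith [h.2]
  refine ⟨_, contDiff_infty_iff_deriv.2 ⟨fun x => (hder x).differentiableAt, by rwa [hd]⟩,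
    HasCompactSupport.intro isCompact_Icc hz, ?_, hd⟩
  refine (closure_minimal (fun x hx => ?_) isClosed_Icc).trans
    (Icc_subset_Ioo ha hb)
  by_contra h
  exact hx (hz x h)

/-- The lemma of du Bois-Reymond: a function whose weak derivative is zero is constant. -/
theorem ae_eq_const_of_integral_mul_deriv_eq_zero {v : L2}
    (hv : ∀ φ : ℝ → ℝ, ContDiff ℝ ∞ φ → HasCompactSupport φ → tsupport φ ⊆ Ioo 0 1 →
      ∫ x in (0 : ℝ)..1, v x * deriv φ x = 0) :
    ∃ c : ℝ, v =ᵐ[unitMeasure] fun _ => c := by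
  let B : ContDiffBump (1 / 2 : ℝ) := ⟨1 / 8, 1 / 4, by norm_num, by norm_num⟩
  set η : ℝ → ℝ := B.normed volume with hη
  have hηs : tsupport η = Metric.closedBall (1 / 2 : ℝ) (1 / 4) := B.tsupport_normed_eq
  have hηI : tsupport η ⊆ Ioo 0 1 := by
    rw [hηs, Real.closedBall_eq_Icc]
    exact Icc_subset_Ioo (by norm_num) (by norm_num)
  have hηc : ContDiff ℝ ∞ η := B.contDiff_normed
  have hη1 : ∫ x in (0 : ℝ)..1, η x = 1 := by
    rw [← integral_Ioo_eq_intervalIntegral, setIntegral_eq_integral_of_forall_compl_eq_zero]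
    · exact B.integral_normed
    · intro x hx
      exact image_eq_zero_of_notMem_tsupport fun h => hx (hηI h)
  set c := ∫ x in (0 : ℝ)..1, v x * η x with hc
  refine ⟨c, ?_⟩
  have hint : IntegrableOn (fun x => v x - c) (Ioo 0 1) :=
    ((Lp.memLp v).integrable one_le_two).sub (integrable_const c)
  have key := isOpen_Ioo.ae_eq_zero_of_integral_contDiff_smul_eq_zero hint.locallyIntegrableOn ?_
  · refine ae_unitMeasure_iff.2 ?_
    have h0 : ∀ᵐ x : ℝ, x ≠ 0 := by simp [ae_iff]
    have h1 : ∀ᵐ x : ℝ, x ≠ 1 := by simp [ae_iff]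
    filter_upwards [key, h0, h1] with x hx h0 h1 hm
    exact sub_eq_zero.1 (hx ⟨lt_of_le_of_ne hm.1 h0.symm, lt_of_le_of_ne hm.2 h1⟩)
  intro φ hφ hφc hφs
  rw [← setIntegral_eq_integral_of_forall_compl_eq_zero (s := Ioo 0 1)]
  swap
  · intro x hx
    rw [image_eq_zero_of_notMem_tsupport fun h => hx (hφs h), zero_smul]
  rw [integral_Ioo_eq_intervalIntegral]
  obtain ⟨a, b, ha, hb, hK⟩ := exists_Icc_of_isCompact_subset_Ioo
    (hφc.isCompact.union (hηs ▸ isCompact_closedBall (1 / 2 : ℝ) (1 / 4) : IsCompact (tsupport η)))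
    ⟨1 / 2, Or.inr (by rw [hηs]; simp)⟩ (union_subset hφs hηI)
  set d := ∫ x in (0 : ℝ)..1, φ x with hd
  have hφi := hφ.continuous.intervalIntegrable (μ := volume) 0 1
  have hηi := hηc.continuous.intervalIntegrable (μ := volume) 0 1
  -- Subtracting a multiple of the bump `η` makes `φ` the derivative of a test function.
  have hχs : ∀ x ∉ Icc a b, φ x - d * η x = 0 := by
    intro x hx
    rw [image_eq_zero_of_notMem_tsupport fun h => hx (hK (Or.inl h)),
      image_eq_zero_of_notMem_tsupport fun h => hx (hK (Or.inr h)), mul_zero, sub_zero]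
  have hχ0 : ∫ x in (0 : ℝ)..1, (φ x - d * η x) = 0 := by
    rw [intervalIntegral.integral_sub hφi (hηi.const_mul d), intervalIntegral.integral_const_mul,
      hη1, mul_one, sub_self]
  obtain ⟨ψ, h1, h2, h3, h4⟩ := exists_deriv_eq_of_integral_eq_zero
    (hφ.sub (contDiff_const.mul hηc)) ha hb hχs hχ0
  have h5 := hv ψ h1 h2 h3
  rw [h4] at h5
  have hvi := intervalIntegrable_coe v
  have i1 := hvi.mul_continuousOn hφ.continuous.continuousOn
  have i2 := hvi.mul_continuousOn hηc.continuous.continuousOn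
  have e1 : ∫ x in (0 : ℝ)..1, v x * (φ x - d * η x)
      = (∫ x in (0 : ℝ)..1, v x * φ x) - d * c := by
    rw [hc, ← intervalIntegral.integral_const_mul, ← intervalIntegral.integral_sub i1
      (i2.const_mul d)]
    congr 1; ext x; ring
  have e2 : ∫ x in (0 : ℝ)..1, φ x • (v x - c)
      = (∫ x in (0 : ℝ)..1, v x * φ x) - c * d := by
    rw [hd, ← intervalIntegral.integral_const_mul, ← intervalIntegral.integral_sub i1
      (hφi.const_mul c)]
    congr 1; ext x; simp only [smul_eq_mul]; ring
  rw [e2]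
  linarith

theorem IsWeakDeriv.isPrimitive {u g : L2} (h : IsWeakDeriv 1 u g) : IsPrimitive u g := by
  obtain ⟨U, hU⟩ := exists_ae_eq_primitive g 0
  have hUw : IsWeakDeriv 1 U g := IsPrimitive.isWeakDeriv ⟨0, hU⟩
  have key : ∀ φ : ℝ → ℝ, ContDiff ℝ ∞ φ → HasCompactSupport φ → tsupport φ ⊆ Ioo 0 1 →
      ∫ x in (0 : ℝ)..1, (u - U) x * deriv φ x = 0 := by
    intro φ hφ hφc hφs
    have e1 := h φ hφ hφc hφs
    have e2 := hUw φ hφ hφc hφs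
    rw [← e2, iteratedDeriv_one, integral_Ioo_eq_intervalIntegral,
      integral_Ioo_eq_intervalIntegral] at e1
    have hcont : Continuous (deriv φ) := hφ.continuous_deriv (by simp)
    have i1 := (intervalIntegrable_coe u).mul_continuousOn hcont.continuousOn
    have i2 := (intervalIntegrable_coe U).mul_continuousOn hcont.continuousOn
    rw [← sub_eq_zero, ← intervalIntegral.integral_sub i1 i2] at e1
    refine Eq.trans ?_ e1
    rw [← integral_unitMeasure, ← integral_unitMeasure]
    refine integral_congr_ae ?_
    filter_upwards [Lp.coeFn_sub u U] with x hx
    rw [hx, Pi.sub_apply]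
    ring
  obtain ⟨c, hc⟩ := ae_eq_const_of_integral_mul_deriv_eq_zero key
  refine ⟨c, ?_⟩
  filter_upwards [hc, hU, Lp.coeFn_sub u U] with x h1 h2 h3
  rw [h1, Pi.sub_apply, h2] at h3
  linarith

/-! ### Splines -/

theorem exists_derivative_eq {p : ℕ} {P : Polynomial ℝ} (hP : P ∈ Polynomial.degreeLE ℝ p) :
    ∃ Q ∈ Polynomial.degreeLE ℝ (p + 1 : ℕ), Polynomial.derivative Q = P := by
  have hdeg : P.natDegree < p + 1 := Nat.lt_succ_of_le
    (Polynomial.natDegree_le_of_degree_le (Polynomial.mem_degreeLE.1 hP))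
  refine ⟨∑ i ∈ Finset.range (p + 1), Polynomial.monomial (i + 1) (P.coeff i / (i + 1)),
    Submodule.sum_mem _ fun i hi => ?_, ?_⟩
  · rw [Polynomial.mem_degreeLE]
    refine (Polynomial.degree_monomial_le _ _).trans ?_
    have := Finset.mem_range.1 hi
    exact_mod_cast (by omega : i + 1 ≤ p + 1)
  · rw [Polynomial.derivative_sum]
    conv_rhs => rw [P.as_sum_range' _ hdeg]
    refine Finset.sum_congr rfl fun i _ => ?_
    rw [Polynomial.derivative_monomial, Nat.add_sub_cancel]
    congr 1
    have : (i : ℝ) + 1 ≠ 0 := by positivity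
    push_cast
    field_simp

/-- The class in `L²(0,1)` of a polynomial function. -/
noncomputable def polyL2 (P : Polynomial ℝ) : L2 :=
  (memLp_of_continuousOn P.continuous.continuousOn).toLp fun x => P.eval x

theorem coeFn_polyL2 (P : Polynomial ℝ) : polyL2 P =ᵐ[unitMeasure] fun x => P.eval x :=
  MemLp.coeFn_toLp _

theorem polyL2_mem_splineSpace {p : ℕ} (k : ℤ) (n : ℕ+) {P : Polynomial ℝ}
    (hP : P ∈ Polynomial.degreeLE ℝ p) : polyL2 P ∈ splineSpace p k n :=
  ⟨fun x => P.eval x, ⟨fun _ _ => (by simpa using P.contDiff_aeval (𝕜 := ℝ) _ :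
    ContDiff ℝ _ fun x => P.eval x).contDiffOn, fun _ _ => ⟨P, hP, fun _ _ => rfl⟩⟩,
    coeFn_polyL2 P⟩

theorem eq_of_mem_cell {n : ℕ+} {i j : ℕ} {x : ℝ} (hi : x ∈ cell n i) (hj : x ∈ cell n j) :
    i = j := by
  have hn : (0 : ℝ) < (n : ℕ) := by exact_mod_cast n.pos
  have key : ∀ i : ℕ, x ∈ cell n i → ⌊x * (n : ℕ)⌋₊ = i := by
    intro i hi
    rw [cell, mem_Ico, div_le_iff₀ hn, lt_div_iff₀ hn] at hi
    exact (Nat.floor_eq_iff (i.cast_nonneg.trans hi.1)).2 hi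
  rw [← key i hi, key j hj]

theorem cell_endpoints {n : ℕ+} {j : ℕ} (hj : j < n) :
    0 ≤ (j : ℝ) / (n : ℕ) ∧ (j : ℝ) / (n : ℕ) < ((j : ℝ) + 1) / (n : ℕ) ∧
      ((j : ℝ) + 1) / (n : ℕ) ≤ 1 := by
  have hn : (0 : ℝ) < (n : ℕ) := by exact_mod_cast n.pos
  refine ⟨by positivity, by gcongr; linarith, ?_⟩
  rw [div_le_one hn]
  exact_mod_cast hj

theorem sum_integral_cell (n : ℕ+) {F : ℝ → ℝ} (hF : IntervalIntegrable F volume 0 1) (i : ℕ)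
    (hi : i ≤ n) :
    ∑ j ∈ Finset.range i, ∫ x in ((j : ℝ) / (n : ℕ))..(((j : ℝ) + 1) / (n : ℕ)), F x
      = ∫ x in (0 : ℝ)..((i : ℝ) / (n : ℕ)), F x := by
  have h := intervalIntegral.sum_integral_adjacent_intervals (f := F) (μ := volume)
    (a := fun j : ℕ => (j : ℝ) / (n : ℕ)) (n := i) fun j hj => ?_
  · simpa using h
  · obtain ⟨h1, h2, h3⟩ := cell_endpoints (hj.trans_le hi)
    refine hF.mono_set ?_
    push_cast
    rw [uIcc_of_le h2.le, uIcc_of_le zero_le_one]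
    exact Icc_subset_Icc h1 h3

theorem sum_integral_cell_eq (n : ℕ+) {F : ℝ → ℝ} (hF : IntervalIntegrable F volume 0 1) :
    ∑ j ∈ Finset.range n, ∫ x in ((j : ℝ) / (n : ℕ))..(((j : ℝ) + 1) / (n : ℕ)), F x
      = ∫ x in (0 : ℝ)..1, F x := by
  have hn : ((n : ℕ) : ℝ) ≠ 0 := by exact_mod_cast n.pos.ne'
  rw [sum_integral_cell n hF n le_rfl, div_self hn]

/-- Integration raises both the degree and the smoothness of a spline of maximal smoothness. -/
theorem IsPrimitive.mem_splineSpace {p : ℕ} {m : ℕ+} {u s : L2} (hu : IsPrimitive u s)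
    (hs : s ∈ splineSpace p ((p : ℤ) - 1) m) :
    u ∈ splineSpace (p + 1) (((p + 1 : ℕ) : ℤ) - 1) m := by
  obtain ⟨f, ⟨hfc, hfp⟩, hsf⟩ := hs
  obtain ⟨c, hc⟩ := hu
  have hsf' := ae_unitMeasure_iff.1 hsf
  have hfi : IntervalIntegrable f volume 0 1 := by
    rw [intervalIntegrable_iff_unitMeasure]
    exact (intervalIntegrable_iff_unitMeasure.1 (intervalIntegrable_coe s)).congr hsf
  have hsub : ∀ x ∈ Icc (0 : ℝ) 1, uIcc 0 x ⊆ uIcc (0 : ℝ) 1 := by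
    intro x hx
    rw [uIcc_of_le hx.1, uIcc_of_le zero_le_one]
    exact Icc_subset_Icc_right hx.2
  have hFf : ∀ x ∈ Icc (0 : ℝ) 1, ∫ t in (0 : ℝ)..x, s t = ∫ t in (0 : ℝ)..x, f t := by
    intro x hx
    refine intervalIntegral.integral_congr_ae ?_
    filter_upwards [hsf'] with t ht htm
    have := hsub x hx (uIoc_subset_uIcc htm)
    rw [uIcc_of_le zero_le_one] at this
    exact ht this
  set F : ℝ → ℝ := fun x => c + ∫ t in (0 : ℝ)..x, f t with hF
  refine ⟨F, ⟨?_, ?_⟩, ?_⟩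
  rotate_left 2
  · filter_upwards [hc, ae_restrict_mem measurableSet_Ioo] with x h1 h2
    rw [h1, hF, hFf x (Ioo_subset_Icc_self h2)]
  · intro r hr
    have hFcont : ContinuousOn F (Icc 0 1) := by
      have h := hfi.absolutelyContinuousOnInterval_intervalIntegral (c := 0) (by simp)
      have := h.continuousOn
      rw [uIcc_of_le zero_le_one] at this
      exact continuousOn_const.add this
    obtain _ | r := r
    · simpa using hFcont
    have hfr : ContDiffOn ℝ r f (Icc 0 1) := hfc r (by push_cast at hr; omega)
    have hfcont := hfr.continuousOn
    have hder : ∀ x ∈ Icc (0 : ℝ) 1, HasDerivWithinAt F (f x) (Icc 0 1) x := by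
      intro x hx
      have := Fact.mk hx
      refine HasDerivWithinAt.const_add c ?_
      exact intervalIntegral.integral_hasDerivWithinAt_right (hfi.mono_set (hsub x hx))
        (hfcont.stronglyMeasurableAtFilter_nhdsWithin measurableSet_Icc x) (hfcont x hx)
    have hud : UniqueDiffOn ℝ (Icc (0 : ℝ) 1) := uniqueDiffOn_Icc zero_lt_one
    push_cast
    rw [contDiffOn_succ_iff_derivWithin hud]
    refine ⟨fun x hx => (hder x hx).differentiableWithinAt, by simp, hfr.congr fun x hx => ?_⟩
    exact (hder x hx).derivWithin (hud x hx)
  · intro j hj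
    obtain ⟨P, hP, hfP⟩ := hfp j hj
    obtain ⟨Q, hQ, hQP⟩ := exists_derivative_eq hP
    obtain ⟨h0, -, h1⟩ := cell_endpoints hj
    set a := (j : ℝ) / (m : ℕ)
    refine ⟨Q + Polynomial.C (F a - Q.eval a), Submodule.add_mem _ hQ ?_, fun x hx => ?_⟩
    · rw [Polynomial.mem_degreeLE]
      exact Polynomial.degree_C_le.trans (by exact_mod_cast Nat.zero_le _)
    have hx1 : x < 1 := hx.2.trans_le h1
    have hxa : a ≤ x := hx.1
    have e1 : ∫ t in a..x, f t = Q.eval x - Q.eval a := by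
      rw [← intervalIntegral.integral_eq_sub_of_hasDerivAt (f := fun x => Q.eval x)
        (f' := fun x => P.eval x) (fun t _ => by simpa [hQP] using Q.hasDerivAt t)
        (P.continuous.intervalIntegrable _ _)]
      refine intervalIntegral.integral_congr fun t ht => ?_
      rw [uIcc_of_le hxa] at ht
      exact hfP t ⟨ht.1, ht.2.trans_lt hx.2⟩
    have e2 : F x = F a + ∫ t in a..x, f t := by
      simp only [hF]
      rw [add_assoc, intervalIntegral.integral_add_adjacent_intervals]
      · exact hfi.mono_set (hsub a ⟨h0, hxa.trans hx1.le⟩)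
      · refine hfi.mono_set ?_
        rw [uIcc_of_le hxa, uIcc_of_le zero_le_one]
        exact Icc_subset_Icc h0 hx1.le
    rw [e2, e1, Polynomial.eval_add, Polynomial.eval_C]
    ring

/-! ### Error bounds -/

theorem norm_sub_proj_le (p : ℕ) (k : ℤ) (n : ℕ+) (u : L2) {s : L2}
    (hs : s ∈ splineSpace p k n) : ‖u - proj p k n u‖ ≤ ‖u - s‖ := by
  rw [proj, Submodule.starProjection_minimal]
  exact ciInf_le ⟨0, by rintro _ ⟨x, rfl⟩; exact norm_nonneg _⟩ (⟨s, hs⟩ : splineSpace p k n)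

theorem inner_sub_proj_eq_zero (p : ℕ) (k : ℤ) (n : ℕ+) (u : L2) {s : L2}
    (hs : s ∈ splineSpace p k n) : inner ℝ (u - proj p k n u) s = 0 :=
  Submodule.starProjection_inner_eq_zero _ _ hs

theorem proj_mem (p : ℕ) (k : ℤ) (n : ℕ+) (u : L2) : proj p k n u ∈ splineSpace p k n :=
  Submodule.starProjection_apply_mem _ _

theorem norm_sub_proj_sq_eq_inner (p : ℕ) (k : ℤ) (n : ℕ+) (u : L2) :
    ‖u - proj p k n u‖ ^ 2 = inner ℝ (u - proj p k n u) u := by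
  rw [← real_inner_self_eq_norm_sq]
  conv_lhs => rw [inner_sub_right, inner_sub_proj_eq_zero _ _ _ u (proj_mem _ _ n u), sub_zero]

theorem le_of_sq_le_mul {a b : ℝ} (ha : 0 ≤ a) (hb : 0 ≤ b) (h : a ^ 2 ≤ a * b) : a ≤ b := by
  rcases ha.eq_or_lt with h0 | h0
  · exact h0 ▸ hb
  · exact le_of_mul_le_mul_left (sq a ▸ h) h0

theorem integral_sub_proj_eq_zero (p : ℕ) (k : ℤ) (n : ℕ+) (u : L2) :
    ∫ t in (0 : ℝ)..1, (u - proj p k n u) t = 0 := by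
  have h1 : (1 : Polynomial ℝ) ∈ Polynomial.degreeLE ℝ p := by
    rw [Polynomial.mem_degreeLE]
    exact Polynomial.degree_one_le.trans (by exact_mod_cast Nat.zero_le _)
  have h := inner_sub_proj_eq_zero p k n u (polyL2_mem_splineSpace k n h1)
  rw [inner_eq_intervalIntegral, ← integral_unitMeasure] at h
  rw [← integral_unitMeasure, ← h]
  refine integral_congr_ae ?_
  filter_upwards [coeFn_polyL2 1] with x hx
  rw [hx, Polynomial.eval_one, mul_one]

/-- The cut-off functions of the cells are piecewise constant splines, so that the error of the
projection onto these splines has mean zero on each cell. -/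
theorem integral_cell_sub_proj_eq_zero (m : ℕ+) (u : L2) {j : ℕ} (hj : j < m) :
    ∫ t in ((j : ℝ) / (m : ℕ))..(((j : ℝ) + 1) / (m : ℕ)), (u - proj 0 (-1) m u) t = 0 := by
  have hmem : (memLp_piece m j 0).toLp _ ∈ splineSpace 0 (-1) m := by
    refine ⟨piece m j 0, ⟨fun r hr => by omega, fun i hi => ?_⟩, MemLp.coeFn_toLp _⟩
    refine ⟨Polynomial.C (if i = j then 1 else 0), ?_, fun x hx => ?_⟩
    · rw [Polynomial.mem_degreeLE]
      exact Polynomial.degree_C_le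
    · rw [Polynomial.eval_C, piece]
      split_ifs with hij
      · rw [indicator_of_mem (hij ▸ hx), pow_zero]
      · exact indicator_of_notMem (fun hx' => hij (eq_of_mem_cell hx hx')) _
  have h := inner_sub_proj_eq_zero 0 (-1) m u hmem
  obtain ⟨h1, h2, h3⟩ := cell_endpoints hj
  have h4 : inner ℝ (u - proj 0 (-1) m u) ((memLp_piece m j 0).toLp _)
      = ∫ x in Ico (0 : ℝ) 1, (cell m j).indicator (u - proj 0 (-1) m u) x := by
    rw [inner_eq_intervalIntegral, ← integral_unitMeasure, integral_Ico_eq_integral_Ioo]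
    refine integral_congr_ae ?_
    filter_upwards [(memLp_piece m j 0).coeFn_toLp] with x hx
    rw [hx, piece]
    by_cases hxc : x ∈ cell m j <;> simp [hxc]
  have h5 : Ico (0 : ℝ) 1 ∩ cell m j = cell m j :=
    inter_eq_right.2 (Ico_subset_Ico h1 h3)
  have hcm : MeasurableSet (cell m j) := measurableSet_Ico
  rw [intervalIntegral.integral_of_le h2.le, integral_Ioc_eq_integral_Ioo,
    ← integral_Ico_eq_integral_Ioo, ← h, h4, setIntegral_indicator hcm, h5, cell]

/-- The nodal values of the primitive of a function with mean zero on each cell vanish, so the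
sharp Dirichlet inequality applies on each cell. -/
theorem norm_sub_proj_zero_le (m : ℕ+) {u g : L2} (hu : IsPrimitive u g) :
    ‖u - proj 0 (-1) m u‖ ≤ 1 / ((m : ℕ) * Real.pi) * ‖g‖ := by
  set e := u - proj 0 (-1) m u with he
  set w : ℝ → ℝ := fun x => 0 + ∫ t in (0 : ℝ)..x, e t with hw
  obtain ⟨W, hW⟩ := exists_ae_eq_primitive e 0
  have hm : (0 : ℝ) < (m : ℕ) := by exact_mod_cast m.pos
  have hnode : ∀ j : ℕ, j ≤ m → w (j / (m : ℕ)) = 0 := by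
    intro j hj
    simp only [hw]
    rw [← sum_integral_cell m (intervalIntegrable_coe e) j hj, zero_add]
    exact Finset.sum_eq_zero fun i hi =>
      integral_cell_sub_proj_eq_zero m u ((Finset.mem_range.1 hi).trans_le hj)
  have hwac := absolutelyContinuous_primitive e 0
  have hwd := ae_hasDerivAt_primitive e 0
  have hwi : IntervalIntegrable (fun x => w x ^ 2) volume 0 1 :=
    (hwac.continuousOn.pow 2).intervalIntegrable
  have hcell : ∀ j ∈ Finset.range m,
      ∫ x in ((j : ℝ) / (m : ℕ))..(((j : ℝ) + 1) / (m : ℕ)), w x ^ 2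
        ≤ (1 / ((m : ℕ) * Real.pi)) ^ 2
          * ∫ x in ((j : ℝ) / (m : ℕ))..(((j : ℝ) + 1) / (m : ℕ)), e x ^ 2 := by
    intro j hj
    have hj := Finset.mem_range.1 hj
    obtain ⟨h1, h2, h3⟩ := cell_endpoints hj
    have hsub : uIcc ((j : ℝ) / (m : ℕ)) (((j : ℝ) + 1) / (m : ℕ)) ⊆ uIcc (0 : ℝ) 1 := by
      rw [uIcc_of_le h2.le, uIcc_of_le zero_le_one]
      exact Icc_subset_Icc h1 h3
    have h := integral_sq_le_of_eq_zero_of_eq_zero h2 (hwac.mono hsub)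
      (hwd.mono fun x hx hxm => hx (hsub hxm)) ((intervalIntegrable_coe e).mono_set hsub)
      ((intervalIntegrable_coe_sq e).mono_set hsub) (hnode j hj.le)
      (by exact_mod_cast hnode (j + 1) hj)
    convert h using 3
    field_simp
    ring
  have hWe : ‖W‖ ^ 2 ≤ (1 / ((m : ℕ) * Real.pi) * ‖e‖) ^ 2 := by
    have h1 : ‖W‖ ^ 2 = ∫ x in (0 : ℝ)..1, w x ^ 2 := by
      rw [norm_sq_eq_intervalIntegral, ← integral_unitMeasure, ← integral_unitMeasure]
      refine integral_congr_ae ?_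
      filter_upwards [hW] with x hx
      rw [hx]
    rw [h1, ← sum_integral_cell_eq m hwi, mul_pow, norm_sq_eq_intervalIntegral,
      ← sum_integral_cell_eq m (intervalIntegrable_coe_sq e), Finset.mul_sum]
    exact Finset.sum_le_sum hcell
  have hWe' : ‖W‖ ≤ 1 / ((m : ℕ) * Real.pi) * ‖e‖ :=
    (sq_le_sq₀ (norm_nonneg _) (by positivity)).1 hWe
  have h1 : ‖e‖ ^ 2 = - inner ℝ W g := by
    rw [← hu.inner_eq_neg_inner (integral_sub_proj_eq_zero _ _ m u) hW,
      norm_sub_proj_sq_eq_inner]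
  refine le_of_sq_le_mul (norm_nonneg _) (by positivity) ?_
  calc ‖e‖ ^ 2 = - inner ℝ W g := h1
    _ ≤ ‖W‖ * ‖g‖ := (neg_le_abs _).trans (abs_real_inner_le_norm _ _)
    _ ≤ 1 / ((m : ℕ) * Real.pi) * ‖e‖ * ‖g‖ := by gcongr
    _ = ‖e‖ * (1 / ((m : ℕ) * Real.pi) * ‖g‖) := by ring

/-- The duality step: the error `e` of `u` in degree `p + 1` satisfies `‖e‖² = -⟪W, w⟫`, where `W`
is the primitive of `e` and `w` the error of the derivative of `u` in degree `p`; as `w` is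
orthogonal to the splines of degree `p`, the function `W` may be replaced with its own error. -/
theorem norm_sub_proj_succ_le {p : ℕ} {m : ℕ+} {C : ℝ} (hC0 : 0 ≤ C)
    (hC : ∀ u g : L2, IsPrimitive u g → ‖u - proj p ((p : ℤ) - 1) m u‖ ≤ C * ‖g‖)
    {u g : L2} (hu : IsPrimitive u g) :
    ‖u - proj (p + 1) (((p + 1 : ℕ) : ℤ) - 1) m u‖ ≤ C * ‖g - proj p ((p : ℤ) - 1) m g‖ := by
  set e := u - proj (p + 1) (((p + 1 : ℕ) : ℤ) - 1) m u with he
  set w := g - proj p ((p : ℤ) - 1) m g with hw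
  obtain ⟨S, hS⟩ := exists_ae_eq_primitive (proj p ((p : ℤ) - 1) m g) 0
  have hSp : IsPrimitive S (proj p ((p : ℤ) - 1) m g) := ⟨0, hS⟩
  have hSm := hSp.mem_splineSpace (proj_mem p _ m g)
  obtain ⟨W, hW⟩ := exists_ae_eq_primitive e 0
  have h1 : ‖e‖ ^ 2 = inner ℝ e (u - S) := by
    rw [inner_sub_right, inner_sub_proj_eq_zero _ _ _ u hSm, sub_zero,
      norm_sub_proj_sq_eq_inner]
  have h2 : inner ℝ e (u - S) = - inner ℝ W w :=
    (hu.sub hSp).inner_eq_neg_inner (integral_sub_proj_eq_zero _ _ m u) hW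
  have h3 : inner ℝ W w = inner ℝ (W - proj p ((p : ℤ) - 1) m W) w := by
    rw [inner_sub_left, real_inner_comm w (proj p _ m W),
      inner_sub_proj_eq_zero _ _ _ g (proj_mem _ _ m W), sub_zero]
  have h4 := hC W e ⟨0, hW⟩
  refine le_of_sq_le_mul (norm_nonneg _) (by positivity) ?_
  calc ‖e‖ ^ 2 = - inner ℝ (W - proj p ((p : ℤ) - 1) m W) w := by
        rw [h1, h2, h3]
    _ ≤ ‖W - proj p ((p : ℤ) - 1) m W‖ * ‖w‖ :=
        (neg_le_abs _).trans (abs_real_inner_le_norm _ _)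
    _ ≤ C * ‖e‖ * ‖w‖ := mul_le_mul_of_nonneg_right h4 (norm_nonneg _)
    _ = ‖e‖ * (C * ‖w‖) := by ring

/-- The first-order bound, with the constant of the case `p = 0` in every degree. -/
theorem norm_sub_proj_le_of_isPrimitive (p : ℕ) (m : ℕ+) {u g : L2} (hu : IsPrimitive u g) :
    ‖u - proj p ((p : ℤ) - 1) m u‖ ≤ 1 / ((m : ℕ) * Real.pi) * ‖g‖ := by
  induction p generalizing u g with
  | zero => simpa using norm_sub_proj_zero_le m hu
  | succ p ih =>
    refine (norm_sub_proj_succ_le (by positivity) (fun u g h => ih h) hu).trans ?_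
    gcongr
    simpa using norm_sub_proj_le p ((p : ℤ) - 1) m g (Submodule.zero_mem _)

theorem sobolev_of_isWeakDeriv {s : ℕ} {f g : L2} (hf : f ∈ sobolev (s + 1))
    (hg : IsWeakDeriv 1 f g) : g ∈ sobolev s := by
  intro r hr
  obtain ⟨h, hh⟩ := hf (r + 1) (by omega)
  exact ⟨h, hg.of_succ hh⟩

/-- Every derivative lowers the degree of the splines by one, which is possible `q` times as
`q ≤ p`. -/
theorem pow_mem_errorBounds {p q : ℕ} (hpq : q ≤ p) (m : ℕ+) :
    (1 / ((m : ℕ) * Real.pi)) ^ (q + 1) ∈ errorBounds p ((p : ℤ) - 1) m q := by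
  induction q generalizing p with
  | zero =>
    intro f _ g hg
    rw [zero_add, pow_one]
    exact norm_sub_proj_le_of_isPrimitive p m hg.isPrimitive
  | succ q ih =>
    intro f hf g hg
    obtain ⟨p, rfl⟩ : ∃ p', p = p' + 1 := ⟨p - 1, by omega⟩
    obtain ⟨f', hf'⟩ := hf 1 (by omega)
    have h1 := norm_sub_proj_succ_le (by positivity)
      (fun u g h => norm_sub_proj_le_of_isPrimitive p m h)
      hf'.isPrimitive
    have h2 := ih (by omega : q ≤ p) f' (sobolev_of_isWeakDeriv hf hf') g (hf'.of_succ hg)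
    refine h1.trans ((mul_le_mul_of_nonneg_left h2 (by positivity)).trans_eq ?_)
    ring

/-! ### Monic polynomials of least norm -/

/-- The Beta integral with integer exponents, on `[a, b]`. -/
theorem integral_sub_pow_mul_sub_pow (a b : ℝ) (i k : ℕ) :
    ∫ x in a..b, (x - a) ^ i * (b - x) ^ k
      = (i.factorial * k.factorial : ℝ) / (i + k + 1).factorial * (b - a) ^ (i + k + 1) := by
  induction k generalizing i with
  | zero =>
    simp only [pow_zero, mul_one, add_zero, Nat.factorial_zero, Nat.cast_one]
    rw [intervalIntegral.integral_comp_sub_right (fun x => x ^ i), integral_pow, sub_self,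
      Nat.factorial_succ]
    have := i.factorial_ne_zero
    push_cast
    field_simp
    simp
  | succ k ih =>
    have hi : (i : ℝ) + 1 ≠ 0 := by positivity
    have h := intervalIntegral.integral_mul_deriv_eq_deriv_mul (a := a) (b := b)
      (u := fun x => (b - x) ^ (k + 1)) (v := fun x => (x - a) ^ (i + 1) / (i + 1))
      (u' := fun x => -((k + 1) * (b - x) ^ k)) (v' := fun x => (x - a) ^ i)
      (fun x _ => by
        have := ((hasDerivAt_id x).const_sub b).pow (k + 1)
        refine this.congr_deriv ?_
        simp)
      (fun x _ => by
        have := (((hasDerivAt_id x).sub_const a).pow (i + 1)).div_const ((i : ℝ) + 1)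
        refine this.congr_deriv ?_
        simp
        field_simp)
      (Continuous.intervalIntegrable (by fun_prop) _ _)
      (Continuous.intervalIntegrable (by fun_prop) _ _)
    have e1 : ∫ x in a..b, (x - a) ^ i * (b - x) ^ (k + 1)
        = ∫ x in a..b, (b - x) ^ (k + 1) * (x - a) ^ i := by
      congr 1; ext x; ring
    have e2 : ∫ x in a..b, -(((k : ℝ) + 1) * (b - x) ^ k) * ((x - a) ^ (i + 1) / (i + 1))
        = -((k + 1) / (i + 1)) * ∫ x in a..b, (x - a) ^ (i + 1) * (b - x) ^ k := by
      rw [← intervalIntegral.integral_const_mul]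
      congr 1; ext x; ring
    rw [e1, h, e2, ih, show i + 1 + k + 1 = i + (k + 1) + 1 by ring, i.factorial_succ,
      k.factorial_succ]
    simp only [sub_self, ne_eq, Nat.add_eq_zero_iff, one_ne_zero, and_false, not_false_eq_true,
      zero_pow, zero_mul, zero_div, mul_zero, zero_sub]
    push_cast
    field_simp

/-- Repeated integration by parts: no boundary terms arise, as the derivatives of `ψ` of order
less than `N` vanish at both end points. -/
theorem integral_mul_iterate_derivative {a b : ℝ} {N : ℕ} (P ψ : Polynomial ℝ)
    (ha : ∀ r < N, (Polynomial.derivative^[r] ψ).eval a = 0)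
    (hb : ∀ r < N, (Polynomial.derivative^[r] ψ).eval b = 0) :
    ∫ x in a..b, P.eval x * (Polynomial.derivative^[N] ψ).eval x
      = (-1) ^ N * ∫ x in a..b, (Polynomial.derivative^[N] P).eval x * ψ.eval x := by
  induction N generalizing P with
  | zero => simp
  | succ N ih =>
    have h := intervalIntegral.integral_mul_deriv_eq_deriv_mul (a := a) (b := b)
      (u := fun x => P.eval x) (v := fun x => (Polynomial.derivative^[N] ψ).eval x)
      (fun x _ => P.hasDerivAt x) (fun x _ => (Polynomial.derivative^[N] ψ).hasDerivAt x)
      (P.derivative.continuous.intervalIntegrable _ _)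
      ((Polynomial.derivative^[N] ψ).derivative.continuous.intervalIntegrable _ _)
    rw [Function.iterate_succ_apply', h, ha N N.lt_succ_self, hb N N.lt_succ_self,
      ih P.derivative (fun r hr => ha r (by omega)) (fun r hr => hb r (by omega)),
      Function.iterate_succ_apply, pow_succ]
    ring

theorem iterate_derivative_of_monic {Q : Polynomial ℝ} {N : ℕ} (hQ : Q.Monic)
    (hN : Q.natDegree = N) : Polynomial.derivative^[N] Q = Polynomial.C (N.factorial : ℝ) := by
  ext i
  rw [Polynomial.coeff_iterate_derivative, Polynomial.coeff_C]
  split_ifs with hi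
  · subst hi
    rw [zero_add, Nat.descFactorial_self, ← hN, hQ.coeff_natDegree]
    simp
  · rw [Polynomial.coeff_eq_zero_of_natDegree_lt (by omega), smul_zero]

/-- The `L²` norm of a monic polynomial of degree `N` is at least that of the monic Legendre
polynomial, a multiple of the `N`-th derivative `φ` of `((x - a) (x - b)) ^ N`: integration by parts
computes both `⟪Q, φ⟫` and `‖φ‖²`. -/
theorem le_integral_sq_of_monic {a b : ℝ} (hab : a ≤ b) {Q : Polynomial ℝ} {N : ℕ} (hQ : Q.Monic)
    (hN : Q.natDegree = N) :
    (N.factorial : ℝ) ^ 4 / ((2 * N).factorial * (2 * N + 1).factorial) * (b - a) ^ (2 * N + 1)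
      ≤ ∫ x in a..b, Q.eval x ^ 2 := by
  set ψ : Polynomial ℝ := ((Polynomial.X - Polynomial.C a) * (Polynomial.X - Polynomial.C b)) ^ N
    with hψ
  set φ := Polynomial.derivative^[N] ψ with hφ
  set β : ℝ := (N.factorial * N.factorial : ℝ) / (N + N + 1).factorial * (b - a) ^ (N + N + 1)
    with hβ
  have hmon : ((Polynomial.X - Polynomial.C a) * (Polynomial.X - Polynomial.C b)).Monic :=
    (Polynomial.monic_X_sub_C a).mul (Polynomial.monic_X_sub_C b)
  have hψm : ψ.Monic := hmon.pow N
  have hψd : ψ.natDegree = N + N := by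
    rw [hψ, hmon.natDegree_pow, (Polynomial.monic_X_sub_C a).natDegree_mul
      (Polynomial.monic_X_sub_C b), Polynomial.natDegree_X_sub_C, Polynomial.natDegree_X_sub_C]
    ring
  have hint : (-1) ^ N * ∫ x in a..b, ψ.eval x = β := by
    rw [hβ, ← integral_sub_pow_mul_sub_pow, ← intervalIntegral.integral_const_mul]
    congr 1; ext x
    simp only [hψ, Polynomial.eval_pow, Polynomial.eval_mul, Polynomial.eval_sub,
      Polynomial.eval_X, Polynomial.eval_C]
    rw [← mul_pow, ← mul_pow]
    ring
  have hroot : ∀ c, (c = a ∨ c = b) → ∀ r < N, (Polynomial.derivative^[r] ψ).eval c = 0 := by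
    intro c hc r hr
    obtain ⟨R, hR⟩ := Polynomial.pow_sub_dvd_iterate_derivative_pow
      ((Polynomial.X - Polynomial.C a) * (Polynomial.X - Polynomial.C b)) N r
    rw [hψ, hR, Polynomial.eval_mul, Polynomial.eval_pow]
    rcases hc with rfl | rfl <;> simp [Nat.sub_ne_zero_of_lt hr]
  have h1 : ∫ x in a..b, Q.eval x * φ.eval x = N.factorial * β := by
    rw [hφ, integral_mul_iterate_derivative Q ψ (hroot a (Or.inl rfl)) (hroot b (Or.inr rfl)),
      iterate_derivative_of_monic hQ hN, ← hint]
    simp only [Polynomial.eval_C, intervalIntegral.integral_const_mul]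
    ring
  have h2 : ∫ x in a..b, φ.eval x * φ.eval x = (2 * N).factorial * β := by
    conv_lhs => rw [hφ]
    rw [integral_mul_iterate_derivative _ ψ (hroot a (Or.inl rfl)) (hroot b (Or.inr rfl)),
      ← Function.iterate_add_apply, iterate_derivative_of_monic hψm hψd, ← hint, two_mul]
    simp only [Polynomial.eval_C, intervalIntegral.integral_const_mul]
    ring
  have hf : ((2 * N).factorial : ℝ) ≠ 0 := by exact_mod_cast (2 * N).factorial_ne_zero
  -- The coefficient of the projection of `Q` onto `φ`; the inequality below is Bessel's.
  set t : ℝ := N.factorial / (2 * N).factorial with ht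
  have h3 : 0 ≤ ∫ x in a..b, (Q.eval x - t * φ.eval x) ^ 2 :=
    intervalIntegral.integral_nonneg hab fun x _ => sq_nonneg _
  have h4 : ∫ x in a..b, (Q.eval x - t * φ.eval x) ^ 2
      = (∫ x in a..b, Q.eval x ^ 2) - 2 * t * (∫ x in a..b, Q.eval x * φ.eval x)
        + t ^ 2 * ∫ x in a..b, φ.eval x * φ.eval x := by
    have i1 : IntervalIntegrable (fun x => Q.eval x ^ 2) volume a b :=
      Continuous.intervalIntegrable (by fun_prop) _ _
    have i2 : IntervalIntegrable (fun x => 2 * t * (Q.eval x * φ.eval x)) volume a b :=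
      Continuous.intervalIntegrable (by fun_prop) _ _
    have i3 : IntervalIntegrable (fun x => t ^ 2 * (φ.eval x * φ.eval x)) volume a b :=
      Continuous.intervalIntegrable (by fun_prop) _ _
    rw [← intervalIntegral.integral_const_mul, ← intervalIntegral.integral_const_mul,
      ← intervalIntegral.integral_sub i1 i2, ← intervalIntegral.integral_add (i1.sub i2) i3]
    congr 1; ext x; ring
  rw [h4, h1, h2] at h3
  have h5 : (N.factorial : ℝ) ^ 4 / ((2 * N).factorial * (2 * N + 1).factorial)
      * (b - a) ^ (2 * N + 1) = 2 * t * (N.factorial * β) - t ^ 2 * ((2 * N).factorial * β) := by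
    rw [ht, hβ, ← two_mul]
    field_simp
    ring
  rw [h5]
  linarith

theorem monic_X_pow_sub {q : ℕ} {P : Polynomial ℝ} (hP : P ∈ Polynomial.degreeLE ℝ q) :
    (Polynomial.X ^ (q + 1) - P).Monic ∧ (Polynomial.X ^ (q + 1) - P).natDegree = q + 1 := by
  have hP' := Polynomial.mem_degreeLE.1 hP
  have hlt : P.degree < ((q + 1 : ℕ) : WithBot ℕ) :=
    hP'.trans_lt (by exact_mod_cast q.lt_succ_self)
  have hnat := Polynomial.natDegree_le_of_degree_le hP'
  refine ⟨Polynomial.monic_X_pow_sub hlt, ?_⟩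
  rw [Polynomial.natDegree_sub_eq_left_of_natDegree_lt, Polynomial.natDegree_X_pow]
  rw [Polynomial.natDegree_X_pow]
  omega

/-- Only the polynomial pieces matter for this bound, the smoothness of the spline does not. -/
theorem le_norm_sq_polyL2_X_pow_sub {q : ℕ} {k : ℤ} {n : ℕ+} {s : L2}
    (hs : s ∈ splineSpace q k n) :
    ((q + 1).factorial : ℝ) ^ 4 / ((2 * (q + 1)).factorial * (2 * (q + 1) + 1).factorial)
        * (1 / (n : ℕ)) ^ (2 * (q + 1))
      ≤ ‖polyL2 (Polynomial.X ^ (q + 1)) - s‖ ^ 2 := by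
  obtain ⟨f, ⟨-, hf⟩, hsf⟩ := hs
  have hn : (0 : ℝ) < (n : ℕ) := by exact_mod_cast n.pos
  set d := polyL2 (Polynomial.X ^ (q + 1)) - s with hd
  have hdf : ∀ᵐ x, x ∈ Icc (0 : ℝ) 1 → d x = x ^ (q + 1) - f x := by
    refine ae_unitMeasure_iff.1 ?_
    filter_upwards [hsf, coeFn_polyL2 (Polynomial.X ^ (q + 1)),
      Lp.coeFn_sub (polyL2 (Polynomial.X ^ (q + 1))) s] with x h1 h2 h3
    rw [h3, Pi.sub_apply, h1, h2, Polynomial.eval_pow, Polynomial.eval_X]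
  rw [norm_sq_eq_intervalIntegral, ← sum_integral_cell_eq n (intervalIntegrable_coe_sq d)]
  set c := ((q + 1).factorial : ℝ) ^ 4 / ((2 * (q + 1)).factorial * (2 * (q + 1) + 1).factorial)
    with hc
  have hcell : ∀ j ∈ Finset.range n, c * (1 / (n : ℕ)) ^ (2 * (q + 1) + 1)
      ≤ ∫ x in ((j : ℝ) / (n : ℕ))..(((j : ℝ) + 1) / (n : ℕ)), d x ^ 2 := by
    intro j hj
    have hj := Finset.mem_range.1 hj
    obtain ⟨h1, h2, h3⟩ := cell_endpoints hj
    obtain ⟨P, hP, hfP⟩ := hf j hj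
    obtain ⟨hm, hdeg⟩ := monic_X_pow_sub hP
    have h := le_integral_sq_of_monic h2.le hm hdeg
    rw [show ((j : ℝ) + 1) / (n : ℕ) - (j : ℝ) / (n : ℕ) = 1 / (n : ℕ) by ring] at h
    refine h.trans_eq ?_
    rw [intervalIntegral.integral_of_le h2.le, intervalIntegral.integral_of_le h2.le,
      ← integral_Ico_eq_integral_Ioc, ← integral_Ico_eq_integral_Ioc]
    refine setIntegral_congr_ae measurableSet_Ico ?_
    filter_upwards [hdf] with x hx hxm
    rw [hx ⟨h1.trans hxm.1, hxm.2.le.trans h3⟩, hfP x hxm]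
    simp
  have hsum := Finset.sum_le_sum hcell
  rw [Finset.sum_const, Finset.card_range, nsmul_eq_mul] at hsum
  refine le_trans (le_of_eq ?_) hsum
  rw [pow_succ]
  field_simp

/-! ### Optimal constants -/

theorem isPrimitive_polyL2 (P : Polynomial ℝ) : IsPrimitive (polyL2 P) (polyL2 P.derivative) := by
  refine ⟨P.eval 0, ?_⟩
  filter_upwards [coeFn_polyL2 P, ae_restrict_mem measurableSet_Ioo] with x hx hxm
  have h : ∫ t in (0 : ℝ)..x, polyL2 P.derivative t = ∫ t in (0 : ℝ)..x, P.derivative.eval t := by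
    refine intervalIntegral.integral_congr_ae ?_
    filter_upwards [ae_unitMeasure_iff.1 (coeFn_polyL2 P.derivative)] with t ht htm
    rw [uIoc_of_le hxm.1.le] at htm
    exact ht ⟨htm.1.le, htm.2.trans hxm.2.le⟩
  rw [hx, h, intervalIntegral.integral_eq_sub_of_hasDerivAt (f := fun x => P.eval x)
    (fun t _ => P.hasDerivAt t) (P.derivative.continuous.intervalIntegrable _ _)]
  ring

theorem isWeakDeriv_polyL2 (P : Polynomial ℝ) (r : ℕ) :
    IsWeakDeriv r (polyL2 P) (polyL2 (Polynomial.derivative^[r] P)) := by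
  induction r with
  | zero => exact isWeakDeriv_zero_self _
  | succ r ih =>
    rw [Function.iterate_succ_apply']
    exact ih.succ (isPrimitive_polyL2 _).isWeakDeriv

theorem norm_polyL2_C {c : ℝ} (hc : 0 ≤ c) : ‖polyL2 (Polynomial.C c)‖ = c := by
  rw [← sq_eq_sq₀ (norm_nonneg _) hc, norm_sq_eq_intervalIntegral, ← integral_unitMeasure]
  rw [integral_congr_ae (g := fun _ => c ^ 2)]
  · rw [integral_unitMeasure]
    simp
  · filter_upwards [coeFn_polyL2 (Polynomial.C c)] with x hx
    rw [hx, Polynomial.eval_C]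

theorem norm_polyL2_X_pow_sub_proj_le {p q : ℕ} {k : ℤ} {n : ℕ+} {C : ℝ}
    (hC : C ∈ errorBounds p k n q) :
    ‖polyL2 (Polynomial.X ^ (q + 1)) - proj p k n (polyL2 (Polynomial.X ^ (q + 1)))‖
      ≤ C * (q + 1).factorial := by
  have h := hC _ (fun r _ => ⟨_, isWeakDeriv_polyL2 (Polynomial.X ^ (q + 1)) r⟩) _
    (isWeakDeriv_polyL2 (Polynomial.X ^ (q + 1)) (q + 1))
  rwa [iterate_derivative_of_monic (Polynomial.monic_X_pow _) (Polynomial.natDegree_X_pow _),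
    norm_polyL2_C (Nat.cast_nonneg _)] at h

theorem nonneg_of_mem_errorBounds {p q : ℕ} {k : ℤ} {n : ℕ+} {C : ℝ}
    (hC : C ∈ errorBounds p k n q) : 0 ≤ C :=
  nonneg_of_mul_nonneg_left ((norm_nonneg _).trans (norm_polyL2_X_pow_sub_proj_le hC))
    (by positivity)

theorem isLeast_optConst {p q : ℕ} {k : ℤ} {n : ℕ+} (h : (errorBounds p k n q).Nonempty) :
    IsLeast (errorBounds p k n q) (optConst p k n q) := by
  have hb : BddBelow (errorBounds p k n q) := ⟨0, fun _ hC => nonneg_of_mem_errorBounds hC⟩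
  have hcl : IsClosed (errorBounds p k n q) := by
    simp only [errorBounds, ofPred_forall]
    refine isClosed_iInter fun f => isClosed_iInter fun _ => isClosed_iInter fun g =>
      isClosed_iInter fun _ => isClosed_le continuous_const (by fun_prop)
  exact ⟨hcl.csInf_mem h hb, fun C hC => csInf_le hb hC⟩

/-- Polynomials of degree `q`, the splines on a single cell, are splines of any smoothness on any
uniform partition. -/
theorem pow_one_div_pi_mem_errorBounds (q : ℕ) (k : ℤ) (n : ℕ+) :
    (1 / Real.pi) ^ (q + 1) ∈ errorBounds q k n q := by
  intro f hf g hg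
  have hmem : proj q ((q : ℤ) - 1) 1 f ∈ splineSpace q k n := by
    obtain ⟨F, ⟨-, hF⟩, hpF⟩ := proj_mem q ((q : ℤ) - 1) 1 f
    obtain ⟨P, hP, hFP⟩ := hF 0 (by simp)
    have : proj q ((q : ℤ) - 1) 1 f = polyL2 P := by
      refine Lp.ext ?_
      filter_upwards [hpF, coeFn_polyL2 P, ae_restrict_mem measurableSet_Ioo] with x h1 h2 h3
      rw [h1, h2, hFP x (by simpa [cell] using ⟨h3.1.le, h3.2⟩)]
    rw [this]
    exact polyL2_mem_splineSpace k n hP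
  have h := pow_mem_errorBounds le_rfl 1 f hf g hg
  simp only [PNat.val_ofNat, Nat.cast_one, one_mul] at h
  exact (norm_sub_proj_le q k n f hmem).trans h

/-- The lower bound for the constants, from the error of `x ^ (q + 1)`. -/
theorem le_of_mem_errorBounds {q : ℕ} {k : ℤ} {n : ℕ+} {C : ℝ} (hC : C ∈ errorBounds q k n q) :
    (q + 1).factorial / ((2 * (q + 1)).factorial * √(2 * (q + 1) + 1)) * (1 / (n : ℕ)) ^ (q + 1)
      ≤ C := by
  have h1 := le_norm_sq_polyL2_X_pow_sub
    (proj_mem q k n (polyL2 (Polynomial.X ^ (q + 1))))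
  have h2 := norm_polyL2_X_pow_sub_proj_le hC
  have h3 := pow_le_pow_left₀ (norm_nonneg _) h2 2
  have h4 := h1.trans h3
  have hf : (0 : ℝ) < (q + 1).factorial := by positivity
  have hs : √(2 * ((q : ℝ) + 1) + 1) ^ 2 = 2 * ((q : ℝ) + 1) + 1 := Real.sq_sqrt (by positivity)
  refine le_of_mul_le_mul_right ((sq_le_sq₀ (by positivity) ?_).1 (le_trans (le_of_eq ?_) h4)) hf
  · exact mul_nonneg (nonneg_of_mem_errorBounds hC) hf.le
  · rw [mul_pow, mul_pow, div_pow, mul_pow, hs, Nat.factorial_succ (2 * (q + 1)), ← pow_mul,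
      mul_comm (q + 1) 2]
    push_cast
    field_simp

/-! ### Comparison of the constants -/

/-- A consequence of the monotonicity of `n! / (√(2n) (n / e) ^ n)`. -/
theorem factorial_two_mul_le {N : ℕ} (hN : N ≠ 0) :
    ((2 * N).factorial : ℝ) ≤ N.factorial * (√2 * (4 * N / Real.exp 1) ^ N) := by
  obtain ⟨a, rfl⟩ := Nat.exists_eq_succ_of_ne_zero hN
  have h : Stirling.stirlingSeq (2 * (a + 1)) ≤ Stirling.stirlingSeq (a + 1) :=
    Stirling.stirlingSeq'_antitone (show a ≤ 2 * a + 1 by omega)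
  simp only [Stirling.stirlingSeq, Nat.succ_eq_add_one] at h ⊢
  set N := a + 1
  have hNpos : (0 : ℝ) < N := by simp [N]; positivity
  have he := Real.exp_pos 1
  rw [div_le_div_iff₀ (by positivity) (by positivity)] at h
  have hs : √(2 * ((2 * N : ℕ) : ℝ)) = √2 * √(2 * N) := by
    rw [← Real.sqrt_mul (by norm_num)]
    push_cast
    rfl
  have hp : (((2 * N : ℕ) : ℝ) / Real.exp 1) ^ (2 * N)
      = (4 * N / Real.exp 1) ^ N * (N / Real.exp 1) ^ N := by
    rw [pow_mul, ← mul_pow]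
    push_cast
    congr 1
    ring
  rw [hs, hp] at h
  refine le_of_mul_le_mul_right (h.trans_eq ?_)
    (by positivity : 0 < √(2 * (N : ℝ)) * (N / Real.exp 1) ^ N)
  ring

/-- Stirling's bound turns `B ^ (q + 1) √(4q + 6) < 1` into a comparison of the upper bound for
smooth splines on `m` cells with the lower bound for splines on `n` cells. -/
theorem one_div_mul_pi_pow_lt {q : ℕ} {m n : ℝ} (hm : 0 < m) (hn : 0 < n)
    (h : (4 / (Real.exp 1 * Real.pi) * (n * (q + 1) / m)) ^ (q + 1) * √(4 * q + 6) < 1) :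
    (1 / (m * Real.pi)) ^ (q + 1)
      < (q + 1).factorial / ((2 * (q + 1)).factorial * √(2 * (q + 1) + 1)) * (1 / n) ^ (q + 1) := by
  have hπ := Real.pi_pos
  have he := Real.exp_pos 1
  have hfac := factorial_two_mul_le q.succ_ne_zero
  simp only [Nat.succ_eq_add_one] at hfac
  have hs : √(4 * (q : ℝ) + 6) = √2 * √(2 * (q + 1) + 1) := by
    rw [← Real.sqrt_mul (by norm_num)]
    congr 1
    ring
  have hr : 0 < √(2 * ((q : ℝ) + 1) + 1) := Real.sqrt_pos.2 (by positivity)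
  have hf2 : (0 : ℝ) < (2 * (q + 1)).factorial := by positivity
  have hf1 : (0 : ℝ) < (q + 1).factorial := by positivity
  rw [div_mul_eq_mul_div, lt_div_iff₀ (by positivity)]
  calc (1 / (m * Real.pi)) ^ (q + 1) * ((2 * (q + 1)).factorial * √(2 * (q + 1) + 1))
      ≤ (1 / (m * Real.pi)) ^ (q + 1) * ((q + 1).factorial
          * (√2 * (4 * ((q + 1 : ℕ) : ℝ) / Real.exp 1) ^ (q + 1)) * √(2 * (q + 1) + 1)) := by
        gcongr
    _ = (q + 1).factorial * (1 / n) ^ (q + 1)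
          * ((4 / (Real.exp 1 * Real.pi) * (n * (q + 1) / m)) ^ (q + 1) * √(4 * q + 6)) := by
        rw [hs]
        have : (4 / (Real.exp 1 * Real.pi) * (n * (q + 1) / m)) ^ (q + 1)
            = (1 / (m * Real.pi)) ^ (q + 1) * (4 * ((q + 1 : ℕ) : ℝ) / Real.exp 1) ^ (q + 1)
              * n ^ (q + 1) := by
          rw [← mul_pow, ← mul_pow]
          push_cast
          congr 1
          field_simp
        rw [this, one_div n, inv_pow]
        field_simp
    _ < (q + 1).factorial * (1 / n) ^ (q + 1) :=
        mul_lt_of_lt_one_right (by positivity) h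

end SplineApprox

open SplineApprox in
theorem mainTheorem6 (q : ℕ) (k : ℤ) (hk : -1 ≤ k) (hkq : k < (q : ℤ) - 1)
    (nbar : ℕ+) (hR : SplineApprox.ratioBound q k nbar < 1)
    (p : ℕ) (hpq : q ≤ p) (n : ℕ+)
    (hn : ((p : ℝ) - (k : ℝ) - 1) / ((q : ℝ) - (k : ℝ) - 1) * ((nbar : ℕ) : ℝ) ≤ ((n : ℕ) : ℝ)) :
    ∃ m : ℕ+,
      ((m : ℕ) : ℤ) = ((q : ℤ) - k) * (((n : ℕ) : ℤ) - 1) + 1 + (q : ℤ) - (p : ℤ) ∧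
      IsLeast (SplineApprox.errorBounds p ((p : ℤ) - 1) m q)
        (SplineApprox.optConst p ((p : ℤ) - 1) m q) ∧
      IsLeast (SplineApprox.errorBounds q k n q) (SplineApprox.optConst q k n q) ∧
      SplineApprox.optConst p ((p : ℤ) - 1) m q < SplineApprox.optConst q k n q := by
  have hqk : (0 : ℝ) < (q : ℝ) - k - 1 := by
    have : (k : ℝ) < (q : ℝ) - 1 := by exact_mod_cast hkq
    linarith
  have hn0 : (0 : ℝ) < (n : ℕ) := by exact_mod_cast n.pos
  have hnb0 : (1 : ℝ) ≤ (nbar : ℕ) := by exact_mod_cast nbar.pos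
  rw [div_mul_eq_mul_div, div_le_iff₀ hqk] at hn
  -- The dimensions of the two spline spaces agree: `M = (q - k) n - (p - k - 1)`.
  set M : ℤ := ((q : ℤ) - k) * (((n : ℕ) : ℤ) - 1) + 1 + (q : ℤ) - (p : ℤ) with hM
  set mb : ℝ := ((q : ℝ) - k) * ((nbar : ℕ) - 1) + 1 with hmb
  have hMr : (M : ℝ) = ((q : ℝ) - k) * n - (p - k - 1) := by
    rw [hM]; push_cast; ring
  have hmb0 : 0 < mb := by
    have : 0 ≤ ((q : ℝ) - k) * ((nbar : ℕ) - 1) :=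
      mul_nonneg (by linarith) (by linarith)
    linarith
  -- The hypothesis on `n` says that the ratio `M / n` is at least its value `mb / nbar` at `p = q`.
  have hratio : mb * (n : ℕ) ≤ (M : ℝ) * (nbar : ℕ) := by
    rw [hMr, hmb]
    linarith
  have hM0 : (0 : ℝ) < M := by
    refine pos_of_mul_pos_left ((mul_pos hmb0 hn0).trans_le hratio) (by linarith)
  have hMZ : 0 < M := by exact_mod_cast hM0
  obtain ⟨m, hm⟩ : ∃ m : ℕ+, ((m : ℕ) : ℤ) = M :=
    ⟨⟨M.toNat, by omega⟩, by simp [hMZ.le]⟩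
  have hmr : ((m : ℕ) : ℝ) = M := by exact_mod_cast hm
  have hmem := pow_mem_errorBounds hpq m
  have hl1 := isLeast_optConst ⟨_, hmem⟩
  have hl2 := isLeast_optConst ⟨_, pow_one_div_pi_mem_errorBounds q k n⟩
  refine ⟨m, hm, hl1, hl2, (hl1.2 hmem).trans_lt (lt_of_lt_of_le ?_ (le_of_mem_errorBounds hl2.1))⟩
  refine one_div_mul_pi_pow_lt (hmr ▸ hM0) hn0 (lt_of_le_of_lt ?_ hR)
  rw [ratioBound, ratioBase]
  have hfrac : (n : ℕ) * ((q : ℝ) + 1) / (m : ℕ) ≤ (nbar : ℕ) * ((q : ℝ) + 1) / mb := by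
    rw [hmr, div_le_div_iff₀ hM0 hmb0]
    have := mul_le_mul_of_nonneg_right hratio (by positivity : (0 : ℝ) ≤ q + 1)
    linarith
  have hπ := Real.pi_pos
  have hm0 : (0 : ℝ) < (m : ℕ) := hmr ▸ hM0
  gcongr
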